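/- Let $f:\mathbb R^N\times\mathbb R\to\mathbb R^N$ be $C^1$. Let $\lambda:\mathbb R\to\mathbb R$ be an asymptotically constant parameter shift: $\lambda$ is differentiable, $\lambda_-<\lambda(s)<\lambda_+$ for all $s$, $\lambda(s)\to\lambda_\pm$ and $\lambda'(s)\to 0$ as $s\to\pm\infty$. An attracting equilibrium means an asymptotically stable one. Let $(X(s),\lambda(s))$ be a stable path from $X_-$ to $X_+$: for each $s\in\mathbb R$ the point $X(s)$ is an attracting equilibrium of $\dot x=f(x,\lambda(s))$, $X_\pm=\lim_{s\to\pm\infty}X(s)$ exist, and $X_\pm$ is an attracting equilibrium of $\dot x=f(x,\lambda_\pm)$, where $X_-$ is moreover hyperbolic (every eigenvalue of $D_xf(X_-,\lambda_-)$ has negative real part). Let $\mathbb B(X_+,\lambda_+)$ be the basin of attraction of $X_+$ for $\dot x=f(x,\lambda_+)$. Fix $\rho\ge 0$ and suppose that the path is forward inflowing stable: for each $s\in\mathbb R$ there is a compact set $K(s)\subset\mathbb R^N$ such that 1. $X(s)\in\operatorname{Int}K(s)$ for all $s$; 2. $K(s_1)\subset K(s_2)$ whenever $s_1<s_2$; 3.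 for every $s$ and every $x_0\in\partial K(s)$ there is $t_0>0$ such that the solution of $\dot y=f(y,\lambda(s+\rho t))$, $y(0)=x_0$, exists on $[0,t_0)$ and lies in $\operatorname{Int}K(s)$ for all $t\in(0,t_0)$ (for $\rho=0$ this is the frozen system $\dot y=f(y,\lambda(s))$); 4. $X_\pm\in\operatorname{Int}K_\pm$, where $K_-=\bigcap_{s}K(s)$ and $K_+=\overline{\bigcup_{s}K(s)}$; 5. $K_+$ is compact and $K_+\subset\mathbb B(X_+,\lambda_+)$. Then for every $r>0$ the system $\dot x=f(x,\lambda(rt))$ has exactly one solution $\gamma:\mathbb R\to\mathbb R^N$ with $\gamma(t)\to X_-$ as $t\to-\infty$, and $\gamma$ has the following properties, where $x(t;x_0,s)$ denotes the solution with value $x_0$ at time $s$. * $\gamma$ is a (local) pullback attractor: there is $\delta>0$ such that for every $t$, for all sufficiently negative $s$, the solution $x(\cdot\,;x_0,s)$ exists on $[s,t]$ whenever $|x_0-\gamma(s)|<\delta$, and $\sup_{|x_0-\gamma(s)|<\delta}|x(t;x_0,s)-\gamma(t)|\to 0$ as $s\to-\infty$. * $\gamma$ end-point tracks $X_+$: $\gamma(t)\to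 X_+$ as $t\to\infty$. * $\gamma$ is (locally) forward attracting: there is $\delta>0$ such that for every $t_0\in\mathbb R$ and every $x_0$ with $|x_0-\gamma(t_0)|<\delta$ the solution $x(t;x_0,t_0)$ exists for all $t\ge t_0$ and $|x(t;x_0,t_0)-\gamma(t)|\to 0$ as $t\to\infty$. -/

import Mathlib

open Set Filter Topology

/-- The phase space `ℝ^N` with its Euclidean norm. -/
abbrev Phase (N : ℕ) : Type := EuclideanSpace ℝ (Fin N)

/-- The basin of attraction of `p` for the autonomous system `ẋ = g x`: all `x₀` whose forward
solution exists for all `t ≥ 0` and converges to `p`. -/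
def basin {N : ℕ} (g : Phase N → Phase N) (p : Phase N) : Set (Phase N) :=
  {x₀ | ∃ x : ℝ → Phase N,
    IsIntegralCurveOn x (fun _ => g) (Ici 0) ∧ x 0 = x₀ ∧ Tendsto x atTop (𝓝 p)}

/-- `p` is an attracting (i.e. asymptotically stable) equilibrium of `ẋ = g x`: an equilibrium that
is Lyapunov stable and attracts a neighbourhood of itself. -/
structure IsAttractingEquilibrium {N : ℕ} (g : Phase N → Phase N) (p : Phase N) : Prop where
  equilibrium : g p = 0
  stable : ∀ ε > 0, ∃ δ > 0, ∀ x₀ ∈ Metric.ball p δ, ∃ x : ℝ → Phase N,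
    IsIntegralCurveOn x (fun _ => g) (Ici 0) ∧ x 0 = x₀ ∧ ∀ t ≥ 0, x t ∈ Metric.ball p ε
  attracting : basin g p ∈ 𝓝 p

/-- Every (complex) eigenvalue of the derivative of `g` at `p` has negative real part. For an
equilibrium `p` of `ẋ = g x` this says that `p` is hyperbolic and stable. -/
def IsLinearlyStable {N : ℕ} (g : Phase N → Phase N) (p : Phase N) : Prop :=
  ∀ μ : ℂ, ((fderiv ℝ g p).toLinearMap.charpoly.map (algebraMap ℝ ℂ)).IsRoot μ → μ.re < 0

/-- An asymptotically constant parameter shift from `lamM` (`λ₋`) to `lamP` (`λ₊`). -/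
structure IsParameterShift (lam : ℝ → ℝ) (lamM lamP : ℝ) : Prop where
  differentiable : Differentiable ℝ lam
  lower : ∀ s, lamM < lam s
  upper : ∀ s, lam s < lamP
  tendsto_atBot : Tendsto lam atBot (𝓝 lamM)
  tendsto_atTop : Tendsto lam atTop (𝓝 lamP)
  deriv_atBot : Tendsto (deriv lam) atBot (𝓝 0)
  deriv_atTop : Tendsto (deriv lam) atTop (𝓝 0)

/-- `(X(s), λ(s))` is a stable path from `XM` (`X₋`) to `XP` (`X₊`): each `X(s)` is an attracting
equilibrium of the frozen system `ẋ = f(x, λ(s))`, `X(s) → X₋`, `X₊` as `s → -∞`, `∞`, and the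
limits are attracting equilibria of the limiting systems. -/
structure IsStablePath {N : ℕ} (f : Phase N → ℝ → Phase N) (lam : ℝ → ℝ) (lamM lamP : ℝ)
    (X : ℝ → Phase N) (XM XP : Phase N) : Prop where
  shift : IsParameterShift lam lamM lamP
  attracting : ∀ s, IsAttractingEquilibrium (fun x => f x (lam s)) (X s)
  tendsto_atBot : Tendsto X atBot (𝓝 XM)
  tendsto_atTop : Tendsto X atTop (𝓝 XP)
  attracting_atBot : IsAttractingEquilibrium (fun x => f x lamM) XM
  attracting_atTop : IsAttractingEquilibrium (fun x => f x lamP) XP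

/-- The stable path is forward inflowing stable. In the inflow condition the solution that starts
at a boundary point `x₀` of `K s` is that of `ẏ = f(y, λ(s + ρ t))`, `y(0) = x₀`: for `ρ = 0` it is
the solution of the frozen system `ẏ = f(y, λ(s))`, and for `ρ = r` it is the solution of the
nonautonomous system with rate `r`, with time counted from the start. -/
def ForwardInflowingStable {N : ℕ} (f : Phase N → ℝ → Phase N) (lam : ℝ → ℝ) (lamP : ℝ)
    (X : ℝ → Phase N) (XM XP : Phase N) (ρ : ℝ) : Prop :=
  ∃ K : ℝ → Set (Phase N),
    (∀ s, IsCompact (K s)) ∧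
    (∀ s, X s ∈ interior (K s)) ∧
    (∀ s₁ s₂, s₁ < s₂ → K s₁ ⊆ K s₂) ∧
    (∀ s, ∀ x₀ ∈ frontier (K s), ∃ t₀ > 0, ∃ y : ℝ → Phase N,
      IsIntegralCurveOn y (fun t x => f x (lam (s + ρ * t))) (Ico 0 t₀) ∧ y 0 = x₀ ∧
      ∀ t ∈ Ioo 0 t₀, y t ∈ interior (K s)) ∧
    XM ∈ interior (⋂ s, K s) ∧
    XP ∈ interior (closure (⋃ s, K s)) ∧
    IsCompact (closure (⋃ s, K s)) ∧
    closure (⋃ s, K s) ⊆ basin (fun x => f x lamP) XP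

/-- `γ` is a (local) pullback attractor of `ẋ = F(t, x)`: a solution on all of `ℝ` such that, for
some `δ > 0` and every `t`, the value at time `t` of the solution starting at time `s` from `x₀`
tends to `γ(t)` as `s → -∞`, uniformly for `x₀` in the `δ`-ball around `γ(s)`. -/
def IsPullbackAttractor {N : ℕ} (F : ℝ → Phase N → Phase N) (γ : ℝ → Phase N) : Prop :=
  IsIntegralCurve γ F ∧
  ∃ δ > 0, ∀ t : ℝ, ∀ ε > 0, ∀ᶠ s in atBot, s ≤ t ∧ ∀ x₀ ∈ Metric.ball (γ s) δ,
    ∃ x : ℝ → Phase N, IsIntegralCurveOn x F (Icc s t) ∧ x s = x₀ ∧ ‖x t - γ t‖ < ε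

/-- The solution `γ` of `ẋ = F(t, x)` is (locally) forward attracting: for some `δ > 0`, every
solution starting at any time `t₀` in the `δ`-ball around `γ(t₀)` exists for all later times and
its distance to `γ` tends to `0`. -/
def IsForwardAttracting {N : ℕ} (F : ℝ → Phase N → Phase N) (γ : ℝ → Phase N) : Prop :=
  ∃ δ > 0, ∀ t₀ : ℝ, ∀ x₀ ∈ Metric.ball (γ t₀) δ,
    ∃ x : ℝ → Phase N, IsIntegralCurveOn x F (Ici t₀) ∧ x t₀ = x₀ ∧
      Tendsto (fun t => ‖x t - γ t‖) atTop (𝓝 0)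

/-! The argument has a trapping part and a part near `XM`. A solution entering the interior of `K s`
from its boundary has initial velocity `f x₀ (lam s)` whatever `ρ` is, so the frozen field is
subtangent to `K s`. Since the `K s` increase, a Nagumo argument
(`IsIntegralCurve.mem_of_subtangent`) shows that a solution in `K (r * t₀)` at time `t₀` lies in `K
(r * t)` for all later `t`, for every rate `r > 0`. It thus stays in a compact subset of the basin
of `XP`. As the field converges to its limit, such a solution repeatedly shadows limit solutions and
tends to `XP` (`IsAsymptoticallyAutonomous.tendsto`).

Near `XM`, hyperbolicity gives a Euclidean norm in which the fields with parameter near `lamM` are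
strictly dissipative. Solutions there contract exponentially: limits of solutions started at `XM`
ever earlier produce `γ`, and contraction gives its uniqueness and pullback attraction. A small ball
around `XM` lies in every `K s`, so `γ` is trapped and tracks `XP`. Forward attraction combines
trapping for early starts, stability of `XP` for late ones and continuous dependence in between.

A cut-off makes all fields bounded and Lipschitz, hence all solutions global; trapping shows
afterwards that the relevant solutions never see it. -/

/-! ### Global flows of bounded Lipschitz fields. -/

section LipschitzODE

variable {E : Type*} [NormedAddCommGroup E] [NormedSpace ℝ E] {v : ℝ → E → E} {K : NNReal}

/-- Integral curves of a Lipschitz field separate at most exponentially, forwards and backwards. -/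
theorem IsIntegralCurve.dist_le_exp (hv : ∀ t, LipschitzWith K (v t)) {x y : ℝ → E}
    (hx : IsIntegralCurve x v) (hy : IsIntegralCurve y v) (s t : ℝ) :
    dist (x t) (y t) ≤ dist (x s) (y s) * Real.exp (K * |t - s|) := by
  rcases le_total s t with h | h
  · rw [abs_of_nonneg (sub_nonneg.2 h)]
    exact dist_le_of_trajectories_ODE hv hx.continuous.continuousOn
      (fun τ _ => (hx τ).hasDerivWithinAt) hy.continuous.continuousOn
      (fun τ _ => (hy τ).hasDerivWithinAt) le_rfl t ⟨h, le_rfl⟩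
  · have key : ∀ {z : ℝ → E}, IsIntegralCurve z v →
        IsIntegralCurve (fun τ => z (-τ)) (fun τ p => -v (-τ) p) := fun {z} hz τ => by
      simpa using! (hz (-τ)).scomp τ (hasDerivAt_neg τ)
    have hx' := key hx
    have hy' := key hy
    have hv' : ∀ τ, LipschitzWith K (fun p => -v (-τ) p) := fun τ =>
      .of_dist_le_mul fun p q => by
        rw [dist_neg_neg]
        exact (hv _).dist_le_mul p q
    have := dist_le_of_trajectories_ODE hv' hx'.continuous.continuousOn
      (fun τ _ => (hx' τ).hasDerivWithinAt) hy'.continuous.continuousOn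
      (fun τ _ => (hy' τ).hasDerivWithinAt) (a := -s) (b := -t) le_rfl (-t)
      ⟨neg_le_neg h, le_rfl⟩
    rw [abs_of_nonpos (sub_nonpos.2 h)]
    simpa [sub_eq_add_neg, add_comm] using this

theorem IsIntegralCurve.eq_of_eq (hv : ∀ t, LipschitzWith K (v t)) {x y : ℝ → E}
    (hx : IsIntegralCurve x v) (hy : IsIntegralCurve y v) {s : ℝ} (h : x s = y s) : x = y := by
  ext t
  have := hx.dist_le_exp hv hy s t
  rw [h, dist_self, zero_mul] at this
  exact dist_le_zero.1 this

/-- A bounded Lipschitz field has a global integral curve through every point. -/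
theorem exists_isIntegralCurve [CompleteSpace E] (hv : ∀ t, LipschitzWith K (v t))
    (hc : ∀ p, Continuous fun t => v t p) {M : NNReal} (hM : ∀ t p, ‖v t p‖ ≤ M)
    (t₀ : ℝ) (p : E) : ∃ x : ℝ → E, IsIntegralCurve x v ∧ x t₀ = p := by
  have loc : ∀ n : ℕ, ∃ α : ℝ → E, α t₀ = p ∧
      ∀ t ∈ Icc (t₀ - n) (t₀ + n), HasDerivWithinAt α (v t (α t)) (Icc (t₀ - n) (t₀ + n)) t := by
    intro n
    have hn : (0 : ℝ) ≤ n := n.cast_nonneg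
    have : IsPicardLindelof v (⟨t₀, by constructor <;> linarith⟩ : Icc (t₀ - n : ℝ) (t₀ + n)) p
        (M * n) 0 M K :=
      { lipschitzOnWith := fun t _ => (hv t).lipschitzOnWith
        continuousOn := fun q _ => (hc q).continuousOn
        norm_le := fun t _ q _ => hM t q
        mul_max_le := by simp }
    exact this.exists_eq_forall_mem_Icc_hasDerivWithinAt₀
  choose α h0 hα using loc
  have hd : ∀ n : ℕ, ∀ t ∈ Ioo (t₀ - n : ℝ) (t₀ + n), HasDerivAt (α n) (v t (α n t)) t :=
    fun n t ht => (hα n t (Ioo_subset_Icc_self ht)).hasDerivAt (Icc_mem_nhds ht.1 ht.2)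
  have agree : ∀ m n : ℕ, m ≤ n → EqOn (α m) (α n) (Ioo (t₀ - m : ℝ) (t₀ + m)) := by
    intro m n hmn t ht
    have hmn' : (m : ℝ) ≤ n := by exact_mod_cast hmn
    refine ODE_solution_unique_of_mem_Ioo (s := fun _ => univ) (fun t _ => (hv t).lipschitzOnWith)
      (t₀ := t₀) ⟨by linarith [ht.1, ht.2], by linarith [ht.1, ht.2]⟩
      (fun t ht => ⟨hd m t ht, trivial⟩)
      (fun t ht => ⟨hd n t ⟨by linarith [ht.1], by linarith [ht.2]⟩, trivial⟩)
      ((h0 m).trans (h0 n).symm) ht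
  -- Glue the local solutions. The `+ 1` puts `t` inside the open interval of its index; the `+ 2`
  -- below lets a single `α n` represent the glued curve on a unit ball around `t`.
  refine ⟨fun t => α (⌈|t - t₀|⌉₊ + 1) t, fun t => ?_, h0 _⟩
  set n := ⌈|t - t₀|⌉₊ + 2 with hn
  have hlt : |t - t₀| + 1 < n := by
    have := Nat.le_ceil |t - t₀|
    rw [hn]; push_cast; linarith
  have mem : ∀ s : ℝ, ∀ k : ℕ, |s - t₀| < k → s ∈ Ioo (t₀ - k : ℝ) (t₀ + k) := fun s k h => by
    rw [abs_lt] at h; constructor <;> linarith [h.1, h.2]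
  have heq : (fun t => α (⌈|t - t₀|⌉₊ + 1) t) =ᶠ[𝓝 t] α n := by
    filter_upwards [Metric.ball_mem_nhds t one_pos] with s hs
    have h1 : |s - t₀| ≤ |t - t₀| + 1 := by
      have := abs_sub_le s t t₀
      rw [Metric.mem_ball, Real.dist_eq] at hs
      linarith
    refine agree _ _ ?_ (mem s _ ?_)
    · have : ⌈|s - t₀|⌉₊ ≤ ⌈|t - t₀|⌉₊ + 1 := by
        rw [Nat.ceil_le]; push_cast
        exact h1.trans (by linarith [Nat.le_ceil |t - t₀|])
      omega
    · push_cast; linarith [Nat.le_ceil |s - t₀|]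
  have := (hd n t (mem t n (by linarith))).congr_of_eventuallyEq heq
  rwa [← heq.eq_of_nhds] at this

end LipschitzODE

/-! ### Subtangency and Nagumo's theorem for growing sets. -/

section Invariance

variable {E : Type*} [NormedAddCommGroup E] [NormedSpace ℝ E] {v : ℝ → E → E} {L : NNReal}

/-- If a curve leaves `p` with velocity `w` and stays in `K`, then `w` is subtangent to `K`. -/
theorem eventually_infDist_le_of_hasDerivWithinAt {K : Set E} {y : ℝ → E} {p w : E} {t₁ : ℝ}
    (ht₁ : 0 < t₁) (hy : HasDerivWithinAt y w (Ico 0 t₁) 0) (h0 : y 0 = p)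
    (hK : ∀ t ∈ Ioo 0 t₁, y t ∈ K) {ε : ℝ} (hε : 0 < ε) :
    ∀ᶠ h in 𝓝[>] (0 : ℝ), Metric.infDist (p + h • w) K ≤ ε * h := by
  have ho := (hasDerivWithinAt_iff_isLittleO.1 hy).def hε
  have hle : 𝓝[>] (0 : ℝ) ≤ 𝓝[Ico 0 t₁] 0 :=
    nhdsWithin_le_of_mem (mem_of_superset (Ioo_mem_nhdsGT ht₁) Ioo_subset_Ico_self)
  filter_upwards [hle ho, Ioo_mem_nhdsGT ht₁] with h hh hmem
  rw [sub_zero, Real.norm_of_nonneg hmem.1.le, h0] at hh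
  refine (Metric.infDist_le_dist_of_mem (hK h hmem)).trans ?_
  rw [dist_comm, dist_eq_norm, ← sub_sub]
  simpa using hh

/-- **Nagumo's theorem** for a nondecreasing family of compact sets: an integral curve of a
Lipschitz field which is subtangent to every member of the family cannot leave the family. -/
theorem IsIntegralCurve.mem_of_subtangent (hv : ∀ t, LipschitzWith L (v t)) {K : ℝ → Set E}
    (hK : ∀ t, IsCompact (K t)) (hmono : Monotone K)
    (hsub : ∀ t, ∀ p ∈ K t, ∀ ε > 0, ∀ᶠ h in 𝓝[>] (0 : ℝ),
      Metric.infDist (p + h • v t p) (K t) ≤ ε * h)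
    {x : ℝ → E} (hx : IsIntegralCurve x v) {t₀ t₁ : ℝ} (ht : t₀ ≤ t₁) (h0 : x t₀ ∈ K t₀) :
    x t₁ ∈ K t₁ := by
  by_contra hnot
  have hne : ∀ t, t₀ ≤ t → (K t).Nonempty := fun t h => ⟨x t₀, hmono h h0⟩
  have hD : 0 < Metric.infDist (x t₁) (K t₁) :=
    ((hK t₁).isClosed.notMem_iff_infDist_pos (hne t₁ ht)).1 hnot
  set d : ℝ → ℝ := fun t => Metric.infDist (x t) (K t) with hd
  -- Barrier with rate `L + 1`: the Lipschitz constant accounts for `L`, and the extra `1` absorbs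
  -- the two errors of size `b c / 2 * h` below.
  obtain ⟨ε, hε, hεD⟩ : ∃ ε > 0, ε * Real.exp ((L + 1) * (t₁ - t₀)) < d t₁ := by
    refine ⟨d t₁ / (2 * Real.exp ((L + 1) * (t₁ - t₀))), by positivity, ?_⟩
    rw [div_mul_eq_mul_div, div_lt_iff₀ (by positivity)]
    nlinarith [mul_pos hD (Real.exp_pos ((L + 1) * (t₁ - t₀)))]
  set b : ℝ → ℝ := fun t => ε * Real.exp ((L + 1) * (t - t₀)) with hb
  have hbpos : ∀ t, 0 < b t := fun t => by positivity
  have hbc : Continuous b := by fun_prop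
  set S : Set ℝ := {t | t ∈ Icc t₀ t₁ ∧ b t < d t} with hS
  have hSne : S.Nonempty := ⟨t₁, ⟨ht, le_rfl⟩, hεD⟩
  have hSb : BddBelow S := ⟨t₀, fun t h => h.1.1⟩
  set c := sInf S with hc
  have hc0 : t₀ ≤ c := le_csInf hSne fun t h => h.1.1
  have hc1 : c ≤ t₁ := csInf_le hSb ⟨⟨ht, le_rfl⟩, hεD⟩
  have good : ∀ τ, t₀ ≤ τ → τ < c → d τ ≤ b τ := fun τ h h' => by
    by_contra hcon
    exact absurd (csInf_le hSb (⟨⟨h, h'.le.trans hc1⟩, not_le.1 hcon⟩ : τ ∈ S)) (not_le.2 h')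
  -- `d` need not be continuous, but as the sets grow it can only jump down, so the bound passes to
  -- `c` from the left.
  have hdc : d c ≤ b c := by
    rcases hc0.eq_or_lt with h | h
    · rw [← h]
      exact (Metric.infDist_zero_of_mem h0).trans_le (hbpos _).le
    · have lim : Tendsto (fun τ => b τ + dist (x c) (x τ)) (𝓝[<] c) (𝓝 (b c + dist (x c) (x c))) :=
        ((hbc.add (continuous_const.dist hx.continuous)).tendsto c).mono_left nhdsWithin_le_nhds
      rw [dist_self, add_zero] at lim
      refine ge_of_tendsto lim ?_
      filter_upwards [Ioo_mem_nhdsLT h] with τ hτ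
      calc d c ≤ Metric.infDist (x c) (K τ) :=
            Metric.infDist_le_infDist_of_subset (hmono hτ.2.le) (hne τ hτ.1.le)
        _ ≤ d τ + dist (x c) (x τ) := Metric.infDist_le_infDist_add_dist
        _ ≤ _ := by gcongr; exact good τ hτ.1.le hτ.2
  -- Compare `x` with the Euler step from a nearest point `p` of `K c`, which stays close to `K c ⊆
  -- K (c + h)`. Hence the barrier is not crossed just after `c`, contradicting the choice of `c`.
  have hright : ∀ᶠ h in 𝓝[>] (0 : ℝ), d (c + h) ≤ b (c + h) := by
    obtain ⟨p, hp, hpd⟩ := (hK c).exists_infDist_eq_dist (hne c hc0) (x c)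
    have ho := (hasDerivAt_iff_isLittleO_nhds_zero.1 (hx c)).def (half_pos (hbpos c))
    filter_upwards [nhdsWithin_le_nhds ho, hsub c p hp _ (half_pos (hbpos c)),
      self_mem_nhdsWithin] with h h1 h2 hpos
    have hpos : 0 < h := hpos
    rw [Real.norm_of_nonneg hpos.le] at h1
    have hdp : ‖x c - p‖ = d c := by rw [hd, ← dist_eq_norm]; exact hpd.symm
    have h3 : ‖h • (v c (x c) - v c p)‖ ≤ h * (L * d c) := by
      rw [norm_smul, Real.norm_of_nonneg hpos.le, ← hdp]
      gcongr
      exact (hv c).norm_sub_le _ _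
    have h4 : dist (x (c + h)) (p + h • v c p) ≤ b c / 2 * h + d c + h * (L * d c) := by
      rw [dist_eq_norm]
      have : x (c + h) - (p + h • v c p) = (x (c + h) - x c - h • v c (x c)) + (x c - p)
          + h • (v c (x c) - v c p) := by rw [smul_sub]; abel
      rw [this]
      exact (norm_add₃_le).trans (by rw [hdp]; gcongr)
    have h5 : b (c + h) = b c * Real.exp ((L + 1) * h) := by
      simp only [hb]
      rw [mul_assoc, ← Real.exp_add]
      ring_nf
    calc d (c + h) ≤ Metric.infDist (x (c + h)) (K c) :=
          Metric.infDist_le_infDist_of_subset (hmono (by linarith)) (hne c hc0)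
      _ ≤ Metric.infDist (p + h • v c p) (K c) + dist (x (c + h)) (p + h • v c p) :=
          Metric.infDist_le_infDist_add_dist
      _ ≤ b c / 2 * h + (b c / 2 * h + b c + h * (L * b c)) := by
          refine add_le_add h2 (h4.trans ?_)
          gcongr
      _ = b c * ((L + 1) * h + 1) := by ring
      _ ≤ b (c + h) := by
          rw [h5]
          exact mul_le_mul_of_nonneg_left (Real.add_one_le_exp _) (hbpos c).le
  obtain ⟨h₀, hh₀, hsubset⟩ := mem_nhdsGT_iff_exists_Ioo_subset.1 hright
  obtain ⟨t, htS, htc⟩ := exists_lt_of_csInf_lt hSne (show sInf S < c + h₀ from by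
    have : 0 < h₀ := hh₀
    linarith)
  rcases (csInf_le hSb htS).eq_or_lt with h | h
  · rw [← hc] at h
    exact absurd (h ▸ hdc) (not_le.2 htS.2)
  · have : d (c + (t - c)) ≤ b (c + (t - c)) := hsubset ⟨sub_pos.2 h, by linarith⟩
    rw [add_sub_cancel] at this
    exact absurd this (not_le.2 htS.2)

end Invariance

/-! ### A Lyapunov norm for a linearly stable operator. -/

section LinearStability

open scoped ENNReal RealInnerProductSpace

/-- By Gelfand's formula, `‖a ^ n‖ ≤ r ^ n` eventually, for some `r < 1`. -/
theorem tendsto_pow_atTop_nhds_zero_of_spectralRadius_lt_one {A : Type*} [NormedRing A]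
    [NormedAlgebra ℂ A] [CompleteSpace A] {a : A} (h : spectralRadius ℂ a < 1) :
    Tendsto (fun n : ℕ => a ^ n) atTop (𝓝 0) := by
  obtain ⟨r, hr, hr1⟩ := ENNReal.lt_iff_exists_nnreal_btwn.1 h
  have hev := (spectrum.pow_nnnorm_pow_one_div_tendsto_nhds_spectralRadius a).eventually_lt_const hr
  have hr1' : (r : ℝ) < 1 := by exact_mod_cast hr1
  refine squeeze_zero_norm' ?_ (tendsto_pow_atTop_nhds_zero_of_lt_one r.2 hr1')
  filter_upwards [hev, eventually_gt_atTop 0] with n hn hpos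
  have hn0 : (n : ℝ) ≠ 0 := by positivity
  have := ENNReal.rpow_le_rpow hn.le (Nat.cast_nonneg (α := ℝ) n)
  rw [← ENNReal.rpow_mul, one_div, inv_mul_cancel₀ hn0, ENNReal.rpow_one, ENNReal.rpow_natCast]
    at this
  exact_mod_cast this

/-- Finitely many points of the open left half-plane are moved into the open unit disc by a
sufficiently short explicit Euler step. -/
theorem exists_norm_one_add_mul_lt_one {S : Set ℂ} (hS : S.Finite) (hre : ∀ μ ∈ S, μ.re < 0) :
    ∃ h : ℝ, 0 < h ∧ ∀ μ ∈ S, ‖1 + (h : ℂ) * μ‖ < 1 := by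
  have : ∀ᶠ h : ℝ in 𝓝[>] (0 : ℝ), ∀ μ ∈ S, ‖1 + (h : ℂ) * μ‖ < 1 := by
    refine (eventually_all_finite hS).2 fun μ hμ => ?_
    have hlim : Tendsto (fun h : ℝ => 2 * μ.re + h * ‖μ‖ ^ 2) (𝓝[>] 0)
        (𝓝 (2 * μ.re + 0 * ‖μ‖ ^ 2)) :=
      ((by fun_prop : Continuous fun h : ℝ => 2 * μ.re + h * ‖μ‖ ^ 2).tendsto 0).mono_left
        nhdsWithin_le_nhds
    filter_upwards [hlim.eventually_lt_const (show 2 * μ.re + 0 * ‖μ‖ ^ 2 < 0 by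
      linarith [hre μ hμ]), self_mem_nhdsWithin] with h hh hpos
    have hpos : 0 < h := hpos
    have : ‖1 + (h : ℂ) * μ‖ ^ 2 = 1 + h * (2 * μ.re + h * ‖μ‖ ^ 2) := by
      rw [Complex.sq_norm, Complex.sq_norm, Complex.normSq_apply, Complex.normSq_apply]
      simp
      ring
    refine (sq_lt_one_iff₀ (norm_nonneg _)).1 ?_
    rw [this]
    nlinarith
  obtain ⟨h, hh, hpos⟩ := (this.and self_mem_nhdsWithin).exists
  exact ⟨h, hpos, hh⟩

-- Over `ℂ` the spectrum of `1 + h • M` consists of the `1 + h * μ`, which lie in the open unit disc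
-- for a suitable Euler step `h`. The conclusion is entrywise so that it depends on no matrix norm.
attribute [local instance] Matrix.linftyOpNormedRing Matrix.linftyOpNormedAlgebra in
theorem Matrix.exists_tendsto_one_add_smul_pow {n : Type*} [Fintype n] [DecidableEq n]
    (M : Matrix n n ℝ)
    (hM : ∀ μ : ℂ, (M.charpoly.map (algebraMap ℝ ℂ)).IsRoot μ → μ.re < 0) :
    ∃ h : ℝ, 0 < h ∧ ∀ i j, Tendsto (fun k : ℕ => ((1 + h • M) ^ k) i j) atTop (𝓝 0) := by
  rcases isEmpty_or_nonempty n with hn | hn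
  · exact ⟨1, one_pos, fun i => isEmptyElim i⟩
  set Mc : Matrix n n ℂ := M.map (algebraMap ℝ ℂ) with hMc
  have hspec : ∀ μ ∈ spectrum ℂ Mc, μ.re < 0 := fun μ hμ => hM μ (by
    rw [Matrix.mem_spectrum_iff_isRoot_charpoly, hMc, Matrix.charpoly_map] at hμ
    exact hμ)
  obtain ⟨h, hh, hlt⟩ := exists_norm_one_add_mul_lt_one (Matrix.finite_spectrum Mc) hspec
  refine ⟨h, hh, fun i j => ?_⟩
  have hrad : spectralRadius ℂ (1 + (h : ℂ) • Mc) < 1 := by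
    refine spectrum.spectralRadius_lt_of_forall_lt _ (r := 1) fun z hz => ?_
    have hp : (1 + (h : ℂ) • Mc) = Polynomial.aeval Mc (1 + Polynomial.C (h : ℂ) * Polynomial.X) := by
      simp [Algebra.smul_def]
    rw [hp, spectrum.map_polynomial_aeval] at hz
    obtain ⟨μ, hμ, rfl⟩ := hz
    have := hlt μ hμ
    rw [← NNReal.coe_lt_coe]
    simpa using this
  have hpow := tendsto_pow_atTop_nhds_zero_of_spectralRadius_lt_one hrad
  have hentry : Continuous (Matrix.entryLinearMap ℂ ℂ i j) :=
    LinearMap.continuous_of_finiteDimensional _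
  have := (hentry.tendsto 0).comp hpow
  rw [map_zero] at this
  have hcast : ∀ k : ℕ, ((1 + (h : ℂ) • Mc) ^ k) i j = (((1 + h • M) ^ k) i j : ℝ) := by
    intro k
    have : (1 + (h : ℂ) • Mc) = (algebraMap ℝ ℂ).mapMatrix (1 + h • M) := by
      ext a b
      by_cases hab : a = b <;> simp [hMc, hab]
    rw [this, ← map_pow]
    simp
  have hre := (Complex.continuous_re.tendsto 0).comp this
  refine hre.congr fun k => ?_
  exact (congrArg Complex.re (hcast k)).trans (Complex.ofReal_re _)

variable {E : Type*} [NormedAddCommGroup E] [InnerProductSpace ℝ E] [FiniteDimensional ℝ E]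

/-- The matrix statement transported along a choice of basis; a power of the Euler step is a
contraction, from which the Lyapunov norm is built. -/
theorem ContinuousLinearMap.exists_norm_one_add_smul_pow_le (A : E →L[ℝ] E)
    (hA : ∀ μ : ℂ, (A.toLinearMap.charpoly.map (algebraMap ℝ ℂ)).IsRoot μ → μ.re < 0) :
    ∃ h : ℝ, 0 < h ∧ ∃ m : ℕ, 0 < m ∧ ‖(1 + h • A) ^ m‖ ≤ 1 / 2 := by
  let b := Module.finBasis ℝ E
  let φ := (LinearMap.toMatrixAlgEquiv b).symm.trans (Module.End.toContinuousLinearMap E)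
  have hM : (LinearMap.toMatrix b b A.toLinearMap).charpoly = A.toLinearMap.charpoly :=
    LinearMap.charpoly_toMatrix _ b
  obtain ⟨h, hh, hlim⟩ := Matrix.exists_tendsto_one_add_smul_pow
    (LinearMap.toMatrix b b A.toLinearMap) (by rwa [hM])
  have hφ : Continuous φ.toLinearMap := LinearMap.continuous_of_finiteDimensional _
  have hA' : φ (LinearMap.toMatrix b b A.toLinearMap) = A := by
    have : LinearMap.toMatrix b b A.toLinearMap = LinearMap.toMatrixAlgEquiv b A.toLinearMap := rfl
    rw [this, AlgEquiv.trans_apply, AlgEquiv.symm_apply_apply]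
    rfl
  have hlim' : Tendsto (fun k : ℕ => (1 + h • LinearMap.toMatrix b b A.toLinearMap) ^ k) atTop
      (𝓝 0) := tendsto_pi_nhds.2 fun i => tendsto_pi_nhds.2 fun j => hlim i j
  have hlimA : Tendsto (fun k : ℕ => (1 + h • A) ^ k) atTop (𝓝 0) := by
    have := (hφ.tendsto 0).comp hlim'
    rw [map_zero] at this
    refine this.congr fun k => ?_
    change φ _ = _
    rw [map_pow, map_add, map_one, map_smul, hA']
  have hev := hlimA.norm.eventually_le_const (show ‖(0 : E →L[ℝ] E)‖ < 1 / 2 by simp)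
  obtain ⟨m, hm, hpos⟩ := (hev.and (eventually_gt_atTop 0)).exists
  exact ⟨h, hh, m, hpos, hm⟩

/-- A linearly stable operator is strictly dissipative with respect to an equivalent Euclidean
norm, which is presented as the pull-back of a Hilbert norm along a linear embedding. -/
theorem ContinuousLinearMap.exists_dissipative_embedding (A : E →L[ℝ] E)
    (hA : ∀ μ : ℂ, (A.toLinearMap.charpoly.map (algebraMap ℝ ℂ)).IsRoot μ → μ.re < 0) :
    ∃ (m : ℕ) (J : E →L[ℝ] PiLp 2 fun _ : Fin m => E) (c : ℝ), 0 < c ∧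
      (∀ x, ‖x‖ ≤ ‖J x‖) ∧ ∀ x, ⟪J x, J (A x)⟫ ≤ -c * ‖x‖ ^ 2 := by
  obtain ⟨h, hh, m, hm, hle⟩ := A.exists_norm_one_add_smul_pow_le hA
  set B : E →L[ℝ] E := 1 + h • A with hB
  -- `‖J x‖ ^ 2` is the sum of `‖(B ^ k) x‖ ^ 2` over `k < m`, which telescopes under `x ↦ B x`.
  let J : E →L[ℝ] PiLp 2 fun _ : Fin m => E :=
    (PiLp.continuousLinearEquiv 2 ℝ (fun _ : Fin m => E)).symm.toContinuousLinearMap ∘L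
      ContinuousLinearMap.pi fun k : Fin m => B ^ (k : ℕ)
  have hJ : ∀ x, ‖J x‖ ^ 2 = ∑ k ∈ Finset.range m, ‖(B ^ k) x‖ ^ 2 := fun x => by
    rw [PiLp.norm_sq_eq_of_L2, Finset.sum_range]
    rfl
  -- Telescoping lowers the squared norm by at least `(1 - 1 / 4) * ‖x‖ ^ 2`, while expanding `J x +
  -- h • J (A x)` changes it by at least `2 * h * ⟪J x, J (A x)⟫`; hence the rate `3 / (8 * h)`.
  refine ⟨m, J, 3 / (8 * h), by positivity, fun x => ?_, fun x => ?_⟩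
  · refine le_of_sq_le_sq ?_ (norm_nonneg _)
    rw [hJ]
    have := Finset.single_le_sum (f := fun k => ‖(B ^ k) x‖ ^ 2) (fun k _ => sq_nonneg _)
      (Finset.mem_range.2 hm)
    simpa using this
  · have hstep : ‖J (B x)‖ ^ 2 = ‖J x‖ ^ 2 - ‖x‖ ^ 2 + ‖(B ^ m) x‖ ^ 2 := by
      rw [hJ, hJ]
      have h1 : ∀ k, (B ^ k) (B x) = (B ^ (k + 1)) x := fun k => by rw [pow_succ]; rfl
      simp only [h1]
      have := Finset.sum_range_succ (fun k => ‖(B ^ k) x‖ ^ 2) m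
      rw [Finset.sum_range_succ'] at this
      simp only [pow_zero, one_apply_eq_self] at this
      linarith
    have hBm : ‖(B ^ m) x‖ ^ 2 ≤ 1 / 4 * ‖x‖ ^ 2 := by
      have : ‖(B ^ m) x‖ ≤ 1 / 2 * ‖x‖ := (B ^ m).le_of_opNorm_le hle x
      nlinarith [norm_nonneg ((B ^ m) x), norm_nonneg x]
    have hexp : ‖J (B x)‖ ^ 2 = ‖J x‖ ^ 2 + 2 * (h * ⟪J x, J (A x)⟫) + ‖h • J (A x)‖ ^ 2 := by
      have : J (B x) = J x + h • J (A x) := by simp [hB]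
      rw [this, norm_add_sq_real, inner_smul_right]
    have : h * ⟪J x, J (A x)⟫ ≤ -(3 / 8) * ‖x‖ ^ 2 := by nlinarith [sq_nonneg ‖h • J (A x)‖]
    have h2 : -(3 / (8 * h)) * ‖x‖ ^ 2 = (-(3 / 8) * ‖x‖ ^ 2) / h := by field_simp
    rw [h2, le_div_iff₀ hh]
    linarith

end LinearStability

/-! ### Attraction for asymptotically autonomous fields. -/

section AsymptoticallyAutonomous

variable {E : Type*} [NormedAddCommGroup E] [NormedSpace ℝ E]
  {v : ℝ → E → E} {w : E → E} {L : NNReal} {p : E}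

/-- A complete Lipschitz field `v` which converges uniformly to the autonomous complete Lipschitz
field `w` as time tends to infinity. -/
structure IsAsymptoticallyAutonomous (v : ℝ → E → E) (w : E → E) (L : NNReal) : Prop where
  lipschitz : ∀ t, LipschitzWith L (v t)
  lipschitz_limit : LipschitzWith L w
  exists_curve : ∀ t₀ q, ∃ x : ℝ → E, IsIntegralCurve x v ∧ x t₀ = q
  exists_curve_limit : ∀ q, ∃ y : ℝ → E, IsIntegralCurve y (fun _ => w) ∧ y 0 = q
  eventually_dist_le : ∀ ε > 0, ∀ᶠ t in atTop, ∀ q, dist (v t q) (w q) ≤ ε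

/-- `p` is Lyapunov stable for the complete autonomous field `w`. -/
def IsLyapunovStable (w : E → E) (p : E) : Prop :=
  ∀ ε > 0, ∃ δ > 0, ∀ y : ℝ → E, IsIntegralCurve y (fun _ => w) → y 0 ∈ Metric.ball p δ →
    ∀ t ≥ 0, y t ∈ Metric.ball p ε

/-- All integral curves of `w` that start in `C` converge to `p`. -/
def IsAttractedTo (w : E → E) (C : Set E) (p : E) : Prop :=
  ∀ y : ℝ → E, IsIntegralCurve y (fun _ => w) → y 0 ∈ C → Tendsto y atTop (𝓝 p)

/-- Grönwall over the fixed length `T`, with field error `η` tending to zero. Uniform convergence of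
the fields makes the starting time independent of the starting point. -/
theorem IsAsymptoticallyAutonomous.eventually_shadow (H : IsAsymptoticallyAutonomous v w L)
    (T : ℝ) {ε : ℝ} (hε : 0 < ε) :
    ∀ᶠ t₀ in atTop, ∀ x y : ℝ → E, IsIntegralCurve x v → IsIntegralCurve y (fun _ => w) →
      x t₀ = y 0 → ∀ t ∈ Icc 0 T, dist (x (t₀ + t)) (y t) ≤ ε := by
  have hlim : Tendsto (fun η => gronwallBound 0 L η T) (𝓝[>] 0) (𝓝 0) := by
    have := (gronwallBound_continuous_ε 0 L T).tendsto 0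
    rw [gronwallBound_ε0_δ0] at this
    exact this.mono_left nhdsWithin_le_nhds
  obtain ⟨η, hη, hpos⟩ := ((hlim.eventually_le_const hε).and self_mem_nhdsWithin).exists
  have hpos : 0 < η := hpos
  filter_upwards [eventually_forall_ge_atTop.2 (H.eventually_dist_le η hpos)]
    with t₀ hclose x y hx hy h0 t ht
  have hx' : ∀ t, HasDerivAt (fun t => x (t₀ + t)) (v (t₀ + t) (x (t₀ + t))) t := fun t =>
    (hx (t₀ + t)).comp_const_add t₀ t
  have := dist_le_of_approx_trajectories_ODE (v := fun _ => w) (K := L) (εf := η) (εg := 0)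
    (δ := 0) (a := 0) (b := T)
    (fun _ => H.lipschitz_limit) (HasDerivAt.continuousOn fun t _ => hx' t)
    (fun t _ => (hx' t).hasDerivWithinAt) (fun t ht => hclose _ (by linarith [ht.1]) _)
    hy.continuous.continuousOn (fun t _ => (hy t).hasDerivWithinAt)
    (fun t _ => (dist_self _).le) (by simp [h0]) t ht
  rw [add_zero, sub_zero] at this
  exact this.trans ((gronwallBound_mono le_rfl hpos.le L.2 ht.2).trans hη)

/-- A Lyapunov stable point attracts compact sets uniformly. -/
theorem IsAttractedTo.exists_forall_mem_ball (hw : LipschitzWith L w)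
    (hex : ∀ q, ∃ y : ℝ → E, IsIntegralCurve y (fun _ => w) ∧ y 0 = q)
    (hst : IsLyapunovStable w p) {C : Set E} (hC : IsCompact C) (hatt : IsAttractedTo w C p)
    {ε : ℝ} (hε : 0 < ε) :
    ∃ T > 0, ∀ y : ℝ → E, IsIntegralCurve y (fun _ => w) → y 0 ∈ C →
      ∀ t ≥ T, y t ∈ Metric.ball p ε := by
  obtain ⟨δ, hδ, hstab⟩ := hst ε hε
  refine hC.induction_on (p := fun S => ∃ T > 0, ∀ y : ℝ → E, IsIntegralCurve y (fun _ => w) →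
    y 0 ∈ S → ∀ t ≥ T, y t ∈ Metric.ball p ε) ?_ ?_ ?_ ?_
  · exact ⟨1, one_pos, fun y _ h => h.elim⟩
  · rintro S S' hSS' ⟨T, hT, h⟩
    exact ⟨T, hT, fun y hy h0 => h y hy (hSS' h0)⟩
  · rintro S S' ⟨T, hT, h⟩ ⟨T', hT', h'⟩
    refine ⟨max T T', lt_max_of_lt_left hT, fun y hy h0 t ht => ?_⟩
    exact h0.elim (fun h0 => h y hy h0 t (le_of_max_le_left ht))
      (fun h0 => h' y hy h0 t (le_of_max_le_right ht))
  · intro q hq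
    obtain ⟨y, hy, rfl⟩ := hex q
    obtain ⟨T, hTball, hT⟩ := (((hatt y hy hq).eventually
      (Metric.ball_mem_nhds p (half_pos hδ))).and (eventually_gt_atTop 0)).exists
    -- Neighbours this close are within `δ / 2` of `y` at time `T`, hence in the `δ`-ball of
    -- Lyapunov stability.
    refine ⟨Metric.ball (y 0) (δ / 2 * Real.exp (-(L * T))),
      mem_nhdsWithin_of_mem_nhds (Metric.ball_mem_nhds _ (by positivity)), T, hT,
      fun z hz hz0 t ht => ?_⟩
    have hdist : dist (z T) (y T) < δ / 2 := by
      refine (hz.dist_le_exp (fun _ => hw) hy 0 T).trans_lt ?_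
      rw [sub_zero, abs_of_pos hT]
      calc _ < δ / 2 * Real.exp (-(L * T)) * Real.exp (L * T) := by
            gcongr
            exact hz0
        _ = δ / 2 := by rw [mul_assoc, ← Real.exp_add]; simp
    have hzT : (z ∘ (· + T)) 0 ∈ Metric.ball p δ := by
      simp only [Function.comp_apply, zero_add, Metric.mem_ball]
      have := dist_triangle (z T) (y T) p
      linarith
    simpa using hstab _ (hz.comp_add T) hzT (t - T) (sub_nonneg.2 ht)

/-- An integral curve which eventually stays in a compact subset of the basin of attraction of the
limit field converges to the attractor. -/
theorem IsAsymptoticallyAutonomous.tendsto (H : IsAsymptoticallyAutonomous v w L)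
    (hst : IsLyapunovStable w p) {C : Set E} (hC : IsCompact C) (hatt : IsAttractedTo w C p)
    {x : ℝ → E} (hx : IsIntegralCurve x v) (hxC : ∀ᶠ t in atTop, x t ∈ C) :
    Tendsto x atTop (𝓝 p) := by
  refine Metric.tendsto_nhds.2 fun ε hε => ?_
  obtain ⟨T, hT, hball⟩ := hatt.exists_forall_mem_ball H.lipschitz_limit H.exists_curve_limit hst hC
    (half_pos hε)
  have : ∀ᶠ t in atTop, dist (x (t + T)) p < ε := by
    filter_upwards [H.eventually_shadow T (half_pos hε), hxC] with t ht htC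
    obtain ⟨y, hy, hy0⟩ := H.exists_curve_limit (x t)
    have h1 := ht x y hx hy hy0.symm T ⟨hT.le, le_rfl⟩
    have h2 := hball y hy (hy0 ▸ htC) T le_rfl
    rw [Metric.mem_ball] at h2
    linarith [dist_triangle (x (t + T)) (y T) p]
  have h := (tendsto_atTop_add_const_right atTop (-T) tendsto_id).eventually this
  simpa using h

/-- An asymptotically stable point of the limit field is stable for all late starting times. -/
theorem IsAsymptoticallyAutonomous.exists_forall_mem_ball [ProperSpace E]
    (H : IsAsymptoticallyAutonomous v w L) (hst : IsLyapunovStable w p) {ρ : ℝ} (hρ : 0 < ρ)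
    (hatt : IsAttractedTo w (Metric.closedBall p ρ) p) {ε : ℝ} (hε : 0 < ε) :
    ∃ δ > 0, ∃ t₁ : ℝ, ∀ t₀ ≥ t₁, ∀ x : ℝ → E, IsIntegralCurve x v → x t₀ ∈ Metric.ball p δ →
      ∀ t ≥ t₀, x t ∈ Metric.ball p ε := by
  obtain ⟨δ₁, hδ₁, hstab⟩ := hst (ε / 2) (half_pos hε)
  set δ := min δ₁ ρ with hδdef
  have hδ : 0 < δ := lt_min hδ₁ hρ
  obtain ⟨T, hT, hball⟩ := hatt.exists_forall_mem_ball H.lipschitz_limit H.exists_curve_limit hst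
    (isCompact_closedBall p ρ) (half_pos hδ)
  obtain ⟨t₁, ht₁⟩ := eventually_atTop.1
    (H.eventually_shadow T (lt_min (half_pos hε) (half_pos hδ)))
  refine ⟨δ, hδ, t₁, fun t₀ ht₀ x hx h0 => ?_⟩
  -- The curve stays in the `ε`-ball for time `T` and is back in the `δ`-ball at its end, so the
  -- step can be iterated indefinitely.
  have step : ∀ s ≥ t₁, x s ∈ Metric.ball p δ →
      (∀ t ∈ Icc 0 T, x (s + t) ∈ Metric.ball p ε) ∧ x (s + T) ∈ Metric.ball p δ := by
    intro s hs hxs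
    obtain ⟨y, hy, hy0⟩ := H.exists_curve_limit (x s)
    have hclose := ht₁ s hs x y hx hy hy0.symm
    rw [← hy0] at hxs
    constructor
    · intro t ht
      have h1 := (hclose t ht).trans (min_le_left _ _)
      have h2 := hstab y hy (Metric.ball_subset_ball (min_le_left _ _) hxs) t ht.1
      rw [Metric.mem_ball] at h2 ⊢
      linarith [dist_triangle (x (s + t)) (y t) p]
    · have h1 := (hclose T ⟨hT.le, le_rfl⟩).trans (min_le_right _ _)
      have h2 := hball y hy (Metric.ball_subset_closedBall
        (Metric.ball_subset_ball (min_le_right _ _) hxs)) T le_rfl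
      rw [Metric.mem_ball] at h2 ⊢
      linarith [dist_triangle (x (s + T)) (y T) p]
  have hn : ∀ n : ℕ, x (t₀ + n * T) ∈ Metric.ball p δ := by
    intro n
    induction n with
    | zero => simpa using h0
    | succ n ih =>
      have := (step _ (by nlinarith [n.cast_nonneg (α := ℝ)]) ih).2
      push_cast
      rwa [add_mul, one_mul, ← add_assoc]
  intro t ht
  have h1 := Nat.floor_le (div_nonneg (sub_nonneg.2 ht) hT.le)
  have h2 := Nat.lt_floor_add_one ((t - t₀) / T)
  rw [le_div_iff₀ hT] at h1
  rw [div_lt_iff₀ hT] at h2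
  have := (step _ (by nlinarith [(⌊(t - t₀) / T⌋₊).cast_nonneg (α := ℝ)]) (hn ⌊(t - t₀) / T⌋₊)).1
    (t - (t₀ + ⌊(t - t₀) / T⌋₊ * T)) ⟨by linarith, by linarith⟩
  rwa [add_sub_cancel] at this

/-- If the integral curves of `v` that start late enough from a point of `S` stay in the closed set
`C`, then the integral curves of the limit field that start in the closure of `S` stay in `C`. -/
theorem IsAsymptoticallyAutonomous.mem_of_mem_closure (H : IsAsymptoticallyAutonomous v w L)
    {S C : Set E} (hC : IsClosed C)
    (hS : ∀ q ∈ S, ∀ᶠ t₀ in atTop, ∀ x : ℝ → E, IsIntegralCurve x v → x t₀ = q →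
      ∀ t ≥ t₀, x t ∈ C)
    {y : ℝ → E} (hy : IsIntegralCurve y (fun _ => w)) (hy0 : y 0 ∈ closure S) {t : ℝ}
    (ht : 0 ≤ t) : y t ∈ C := by
  -- Shadowing by late curves of `v` settles starts in `S`; continuous dependence then reaches the
  -- closure.
  have hmem : ∀ z : ℝ → E, IsIntegralCurve z (fun _ => w) → z 0 ∈ S → z t ∈ C := by
    intro z hz hz0
    rw [← hC.closure_eq, Metric.mem_closure_iff]
    intro ε hε
    obtain ⟨t₀, h1, h2⟩ := ((H.eventually_shadow t (half_pos hε)).and (hS _ hz0)).exists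
    obtain ⟨x, hx, hx0⟩ := H.exists_curve t₀ (z 0)
    refine ⟨x (t₀ + t), h2 x hx hx0 _ (by linarith), ?_⟩
    have := h1 x z hx hz hx0 t ⟨ht, le_rfl⟩
    rw [dist_comm]
    linarith
  rw [← hC.closure_eq, Metric.mem_closure_iff]
  intro ε hε
  obtain ⟨q, hq, hdist⟩ := Metric.mem_closure_iff.1 hy0 (ε * Real.exp (-(L * t))) (by positivity)
  obtain ⟨z, hz, rfl⟩ := H.exists_curve_limit q
  refine ⟨z t, hmem z hz hq, ?_⟩
  refine (hy.dist_le_exp (fun _ => H.lipschitz_limit) hz 0 t).trans_lt ?_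
  rw [sub_zero, abs_of_nonneg ht]
  calc _ < ε * Real.exp (-(L * t)) * Real.exp (L * t) := by gcongr
    _ = ε := by rw [mul_assoc, ← Real.exp_add]; simp

end AsymptoticallyAutonomous

/-! ### Contraction near the equilibrium at `-∞`. -/

section Dissipative

open scoped RealInnerProductSpace

variable {E F : Type*} [NormedAddCommGroup E] [NormedSpace ℝ E]
  [NormedAddCommGroup F] [InnerProductSpace ℝ F]
  {v : ℝ → E → E} {J : E →L[ℝ] F} {p : E} {c η₀ t₁ : ℝ} {L : NNReal}

/-- Up to the time `t₁`, the field `v` is strictly dissipative on the `η₀`-ball around `p` for the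
Euclidean norm `‖J ·‖`; moreover `v t p` tends to zero as `t → -∞`. -/
structure IsDissipativeAtBot (v : ℝ → E → E) (J : E →L[ℝ] F) (p : E) (c η₀ t₁ : ℝ) : Prop where
  rate_pos : 0 < c
  radius_pos : 0 < η₀
  norm_le : ∀ x, ‖x‖ ≤ ‖J x‖
  inner_le : ∀ t ≤ t₁, ∀ x y, ‖J (x - p)‖ ≤ η₀ → ‖J (y - p)‖ ≤ η₀ →
    ⟪J (x - y), J (v t x - v t y)⟫ ≤ -c * ‖J (x - y)‖ ^ 2
  tendsto_zero : Tendsto (fun t => v t p) atBot (𝓝 0)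

/-- The squared `J`-distance decays at rate at least `2 * c`, by Grönwall. -/
theorem IsDissipativeAtBot.norm_sub_le (H : IsDissipativeAtBot v J p c η₀ t₁) {x y : ℝ → E}
    (hx : IsIntegralCurve x v) (hy : IsIntegralCurve y v) {s t : ℝ} (hst : s ≤ t) (ht : t ≤ t₁)
    (hxU : ∀ τ ∈ Icc s t, ‖J (x τ - p)‖ ≤ η₀) (hyU : ∀ τ ∈ Icc s t, ‖J (y τ - p)‖ ≤ η₀) :
    ‖J (x t - y t)‖ ≤ ‖J (x s - y s)‖ * Real.exp (-c * (t - s)) := by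
  have hder : ∀ τ, HasDerivAt (fun τ => ‖J (x τ - y τ)‖ ^ 2)
      (2 * ⟪J (x τ - y τ), J (v τ (x τ) - v τ (y τ))⟫) τ := fun τ =>
    (J.hasFDerivAt.comp_hasDerivAt τ ((hx τ).sub (hy τ))).norm_sq
  have := le_gronwallBound_of_liminf_deriv_right_le (K := -2 * c) (ε := 0) (a := s) (b := t)
    (HasDerivAt.continuousOn fun τ _ => hder τ)
    (fun τ _ r hr => (hder τ).hasDerivWithinAt.liminf_right_slope_le hr) le_rfl
    (fun τ hτ => by
      have := H.inner_le τ (hτ.2.le.trans ht) _ _ (hxU τ ⟨hτ.1, hτ.2.le⟩) (hyU τ ⟨hτ.1, hτ.2.le⟩)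
      linarith) t ⟨hst, le_rfl⟩
  rw [gronwallBound_ε0] at this
  refine le_of_sq_le_sq (this.trans_eq ?_) (by positivity)
  rw [mul_pow, ← Real.exp_nat_mul]
  push_cast
  ring_nf

/-- On the sphere of radius `η`, half the derivative of the squared radius is at most `-c * η ^ 2 +
η * ‖J (v t p)‖`, which is negative once `‖J (v t p)‖ < c * η`. -/
theorem IsDissipativeAtBot.exists_invariant (H : IsDissipativeAtBot v J p c η₀ t₁) {η : ℝ}
    (hη : 0 < η) (hle : η ≤ η₀) :
    ∃ t₂ ≤ t₁, ∀ x : ℝ → E, IsIntegralCurve x v → ∀ s t, s ≤ t → t ≤ t₂ →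
      ‖J (x s - p)‖ ≤ η → ‖J (x t - p)‖ ≤ η := by
  have hlim : Tendsto (fun t => ‖J (v t p)‖) atBot (𝓝 0) := by
    have := ((J.continuous.tendsto 0).comp H.tendsto_zero).norm
    rwa [map_zero, norm_zero] at this
  obtain ⟨t₃, ht₃⟩ := eventually_atBot.1
    (hlim.eventually_lt_const (mul_pos H.rate_pos hη))
  refine ⟨min t₁ t₃, min_le_left _ _, fun x hx s t hst ht hs => ?_⟩
  have hder : ∀ τ, HasDerivAt (fun τ => ‖J (x τ - p)‖ ^ 2)
      (2 * ⟪J (x τ - p), J (v τ (x τ))⟫) τ := fun τ =>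
    (J.hasFDerivAt.comp_hasDerivAt τ ((hx τ).sub_const p)).norm_sq
  have := image_le_of_deriv_right_lt_deriv_boundary' (a := s) (b := t) (B := fun _ => η ^ 2)
    (B' := fun _ => 0)
    (HasDerivAt.continuousOn fun τ _ => hder τ) (fun τ _ => (hder τ).hasDerivWithinAt)
    (pow_le_pow_left₀ (norm_nonneg _) hs 2) continuousOn_const
    (fun τ _ => hasDerivWithinAt_const _ _ _) (fun τ hτ heq => ?_) ⟨hst, le_rfl⟩
  · exact le_of_sq_le_sq this hη.le
  · have hτt : τ ≤ min t₁ t₃ := hτ.2.le.trans ht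
    have hτη : ‖J (x τ - p)‖ = η := by
      rwa [sq_eq_sq₀ (norm_nonneg _) hη.le] at heq
    have h1 := H.inner_le τ (hτt.trans (min_le_left _ _)) (x τ) p (hτη.trans_le hle)
      (by simpa using H.radius_pos.le)
    have h2 := ht₃ τ (hτt.trans (min_le_right _ _))
    have h3 := real_inner_le_norm (J (x τ - p)) (J (v τ p))
    have h4 : ⟪J (x τ - p), J (v τ (x τ))⟫ =
        ⟪J (x τ - p), J (v τ (x τ) - v τ p)⟫ + ⟪J (x τ - p), J (v τ p)⟫ := by
      rw [← inner_add_right, ← map_add, sub_add_cancel]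
    rw [hτη] at h1 h3
    rw [h4]
    nlinarith

/-- A curve that tends to `p` at `-∞` is eventually as close to `p` as we like in the norm
`‖J ·‖`. -/
theorem eventually_norm_map_sub_le (J : E →L[ℝ] F) {x : ℝ → E} (hx : Tendsto x atBot (𝓝 p))
    {η : ℝ} (hη : 0 < η) : ∀ᶠ t in atBot, ‖J (x t - p)‖ ≤ η := by
  have : Tendsto (fun t => ‖J (x t - p)‖) atBot (𝓝 ‖J (p - p)‖) :=
    (((by fun_prop : Continuous fun q => ‖J (q - p)‖).tendsto p).comp hx)
  rw [sub_self, map_zero, norm_zero] at this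
  exact this.eventually_le_const hη

/-- Two integral curves that tend to `p` at `-∞` agree for very negative times. -/
theorem IsDissipativeAtBot.eventually_eq (H : IsDissipativeAtBot v J p c η₀ t₁) {x y : ℝ → E}
    (hx : IsIntegralCurve x v) (hy : IsIntegralCurve y v) (hxp : Tendsto x atBot (𝓝 p))
    (hyp : Tendsto y atBot (𝓝 p)) : ∀ᶠ t in atBot, x t = y t := by
  filter_upwards [eventually_forall_le_atBot.2 (eventually_norm_map_sub_le J hxp H.radius_pos),
    eventually_forall_le_atBot.2 (eventually_norm_map_sub_le J hyp H.radius_pos),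
    eventually_le_atBot t₁] with t h1 h2 h3
  have hlim : Tendsto (fun s => ‖J (x s - y s)‖) atBot (𝓝 0) := by
    have := (((by fun_prop : Continuous fun q => ‖J q‖).tendsto (p - p)).comp (hxp.sub hyp))
    rwa [sub_self, map_zero, norm_zero] at this
  have hle : ‖J (x t - y t)‖ ≤ 0 := by
    refine ge_of_tendsto hlim ?_
    filter_upwards [eventually_le_atBot t] with s hs
    refine (H.norm_sub_le hx hy hs h3 (fun τ hτ => h1 τ hτ.2) (fun τ hτ => h2 τ hτ.2)).trans ?_
    refine mul_le_of_le_one_right (norm_nonneg _) (Real.exp_le_one_iff.2 ?_)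
    nlinarith [H.rate_pos]
  exact sub_eq_zero.1 (norm_le_zero_iff.1 ((H.norm_le _).trans hle))

/-- There is an integral curve that tends to `p` at `-∞`. -/
theorem IsDissipativeAtBot.exists_tendsto [ProperSpace E]
    (H : IsDissipativeAtBot v J p c η₀ t₁) (hv : ∀ t, LipschitzWith L (v t))
    (hex : ∀ t₀ q, ∃ x : ℝ → E, IsIntegralCurve x v ∧ x t₀ = q) :
    ∃ γ : ℝ → E, IsIntegralCurve γ v ∧ Tendsto γ atBot (𝓝 p) := by
  obtain ⟨t₂, -, ht₂⟩ := H.exists_invariant H.radius_pos le_rfl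
  choose x hx hx0 using fun n : ℕ => hex (t₂ - n) p
  have hball : ∀ n, x n t₂ ∈ Metric.closedBall p η₀ := fun n => by
    rw [mem_closedBall_iff_norm]
    exact (H.norm_le _).trans (ht₂ _ (hx n) (t₂ - n) t₂ (by simp) le_rfl
      (by simpa [hx0 n] using H.radius_pos.le))
  obtain ⟨q, -, φ, hφ, hlim⟩ := (isCompact_closedBall p η₀).tendsto_subseq hball
  obtain ⟨γ, hγ, rfl⟩ := hex t₂ q
  -- Convergence at the single time `t₂` spreads to every time, backwards included, by the two-sided
  -- exponential bound.
  have hpt : ∀ t, Tendsto (fun k => x (φ k) t) atTop (𝓝 (γ t)) := by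
    intro t
    refine tendsto_iff_dist_tendsto_zero.2 (squeeze_zero (fun _ => dist_nonneg)
      (fun k => (hx (φ k)).dist_le_exp hv hγ t₂ t) ?_)
    simpa using (tendsto_iff_dist_tendsto_zero.1 hlim).mul_const (Real.exp (L * |t - t₂|))
  refine ⟨γ, hγ, Metric.tendsto_nhds.2 fun ε hε => ?_⟩
  obtain ⟨t₃, -, ht₃⟩ := H.exists_invariant (lt_min (half_pos hε) H.radius_pos) (min_le_right _ _)
  filter_upwards [eventually_le_atBot t₃] with t ht
  have : γ t ∈ Metric.closedBall p (ε / 2) := by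
    refine Metric.isClosed_closedBall.mem_of_tendsto (hpt t) ?_
    filter_upwards [hφ.tendsto_atTop.eventually (eventually_ge_atTop ⌈t₂ - t⌉₊)] with k hk
    rw [mem_closedBall_iff_norm]
    refine (H.norm_le _).trans ((ht₃ _ (hx (φ k)) (t₂ - φ k) t ?_ ht ?_).trans (min_le_left _ _))
    · linarith [Nat.ceil_le.1 hk]
    · rw [hx0, sub_self, map_zero, norm_zero]
      exact (lt_min (half_pos hε) H.radius_pos).le
  rw [Metric.mem_closedBall] at this
  linarith

/-- An integral curve that tends to `p` at `-∞` attracts, in the pullback sense, all integral curves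
that start in a tube around it. -/
theorem IsDissipativeAtBot.exists_pullback (H : IsDissipativeAtBot v J p c η₀ t₁)
    (hv : ∀ t, LipschitzWith L (v t)) {γ : ℝ → E} (hγ : IsIntegralCurve γ v)
    (hγp : Tendsto γ atBot (𝓝 p)) :
    ∃ δ > 0, (∀ᶠ s in atBot, Metric.ball (γ s) δ ⊆ Metric.closedBall p η₀) ∧
      ∀ t : ℝ, ∀ ε > 0, ∀ᶠ s in atBot, ∀ x : ℝ → E, IsIntegralCurve x v →
        x s ∈ Metric.ball (γ s) δ → dist (x t) (γ t) < ε := by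
  have hη := H.radius_pos
  obtain ⟨t₂, ht₂, hinv⟩ := H.exists_invariant hη le_rfl
  obtain ⟨t₃, ht₃⟩ := eventually_atBot.1 (eventually_norm_map_sub_le J hγp (half_pos hη))
  -- Half of `η₀` is for the distance to `γ` in the `J`-norm, half for that of `γ` to `p`; `+ 1`
  -- guards against `‖J‖ = 0`.
  set δ := η₀ / 2 / (‖J‖ + 1) with hδdef
  have hδ : 0 < δ := by positivity
  have hJδ : ∀ z : E, ‖z‖ < δ → ‖J z‖ ≤ η₀ / 2 := fun z hz => by
    refine (J.le_opNorm z).trans ?_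
    rw [hδdef, lt_div_iff₀ (by positivity)] at hz
    nlinarith [norm_nonneg z, norm_nonneg J]
  have htube : ∀ s ≤ t₃, ∀ q ∈ Metric.ball (γ s) δ, ‖J (q - p)‖ ≤ η₀ := fun s hs q hq => by
    have h1 := hJδ _ (mem_ball_iff_norm.1 hq)
    have h2 := ht₃ s hs
    have : q - p = (q - γ s) + (γ s - p) := by abel
    rw [this, map_add]
    linarith [norm_add_le (J (q - γ s)) (J (γ s - p))]
  refine ⟨δ, hδ, ?_, fun t ε hε => ?_⟩
  · filter_upwards [eventually_le_atBot t₃] with s hs q hq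
    rw [mem_closedBall_iff_norm]
    exact (H.norm_le _).trans (htube s hs q hq)
  -- Contraction acts on `[s, T]`; from `T` to `t` the error grows by a factor independent of `s`.
  · set T := min t (min t₂ t₃) with hT
    have hTt₂ : T ≤ t₂ := (min_le_right _ _).trans (min_le_left _ _)
    have hTt₃ : T ≤ t₃ := (min_le_right _ _).trans (min_le_right _ _)
    have hlim : Tendsto (fun s => η₀ / 2 * Real.exp (-c * (T - s)) * Real.exp (L * |t - T|)) atBot
        (𝓝 (η₀ / 2 * 0 * Real.exp (L * |t - T|))) := by
      refine ((Real.tendsto_exp_atBot.comp ?_).const_mul _).mul_const _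
      have h1 : Tendsto (fun s => c * s + -(c * T)) atBot atBot :=
        tendsto_atBot_add_const_right _ _ (tendsto_id.const_mul_atBot H.rate_pos)
      refine h1.congr fun s => by ring
    rw [mul_zero, zero_mul] at hlim
    filter_upwards [hlim.eventually_lt_const hε, eventually_le_atBot T] with s hs hsT x hx hxs
    have hxU : ∀ τ ∈ Icc s T, ‖J (x τ - p)‖ ≤ η₀ := fun τ hτ =>
      hinv x hx s τ hτ.1 (hτ.2.trans hTt₂) (htube s (hsT.trans hTt₃) _ hxs)
    have hγU : ∀ τ ∈ Icc s T, ‖J (γ τ - p)‖ ≤ η₀ := fun τ hτ =>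
      (ht₃ τ (hτ.2.trans hTt₃)).trans (half_le_self hη.le)
    have hcontr := H.norm_sub_le hx hγ hsT (hTt₂.trans ht₂) hxU hγU
    have h0 := hJδ _ (mem_ball_iff_norm.1 hxs)
    refine ((hx.dist_le_exp hv hγ T t).trans ?_).trans_lt hs
    gcongr
    rw [dist_eq_norm]
    exact (H.norm_le _).trans (hcontr.trans (by gcongr))

end Dissipative

/-! ### From linear stability to local dissipativity. -/

section DissipativeLinearization

open scoped RealInnerProductSpace

/-- Near a linearly stable equilibrium of `f · a`, the fields `f · b` with `b` close to `a` are
strictly dissipative for a common Euclidean norm. -/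
theorem IsLinearlyStable.exists_dissipative {N : ℕ} {f : Phase N → ℝ → Phase N} {a : ℝ}
    {p : Phase N} (hf : ContDiffAt ℝ 1 (fun z : Phase N × ℝ => f z.1 z.2) (p, a))
    (hp : IsLinearlyStable (fun x => f x a) p) :
    ∃ (m : ℕ) (J : Phase N →L[ℝ] PiLp 2 fun _ : Fin m => Phase N) (c r : ℝ), 0 < c ∧ 0 < r ∧
      (∀ x, ‖x‖ ≤ ‖J x‖) ∧ ∀ b ∈ Metric.ball a r, ∀ x ∈ Metric.ball p r, ∀ y ∈ Metric.ball p r,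
        ⟪J (x - y), J (f x b - f y b)⟫ ≤ -c * ‖J (x - y)‖ ^ 2 := by
  -- Strict differentiability compares two nearby states at the same parameter `b`, uniformly in
  -- `b`.
  obtain ⟨D, hD⟩ : ∃ D, HasStrictFDerivAt (fun z : Phase N × ℝ => f z.1 z.2) D (p, a) :=
    ⟨_, hf.hasStrictFDerivAt one_ne_zero⟩
  have hA : fderiv ℝ (fun x => f x a) p = D ∘L ContinuousLinearMap.inl ℝ (Phase N) ℝ := by
    have h : HasFDerivAt (fun x => f x a) (D ∘L ContinuousLinearMap.inl ℝ (Phase N) ℝ) p :=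
      HasFDerivAt.comp (f := fun x => (x, a)) p hD.hasFDerivAt (hasFDerivAt_prodMk_left p a)
    exact h.fderiv
  rw [IsLinearlyStable, hA] at hp
  obtain ⟨m, J, c, hc, hJ, hdis⟩ := ContinuousLinearMap.exists_dissipative_embedding _ hp
  -- The remainder and the conversion of the rate to the `J`-norm each cost at most `κ * ‖J‖ ^ 2`,
  -- less than `c / 2`.
  set κ := c / (2 * (‖J‖ ^ 2 + 1)) with hκ
  have hκ0 : 0 < κ := by positivity
  have hev := hD.isLittleO.def hκ0
  rw [Metric.eventually_nhds_iff_ball] at hev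
  obtain ⟨r, hr, hball⟩ := hev
  refine ⟨m, J, κ, r, hκ0, hr, hJ, fun b hb x hx y hy => ?_⟩
  have hmem : ((x, b), (y, b)) ∈
      Metric.ball (((p, a), (p, a)) : (Phase N × ℝ) × (Phase N × ℝ)) r := by
    simp only [← ball_prod_same, mem_prod]
    exact ⟨⟨hx, hb⟩, hy, hb⟩
  have hrem := hball _ hmem
  simp only [Prod.mk_sub_mk, sub_self] at hrem
  set R := f x b - f y b - D (x - y, 0) with hR
  have hnorm : ‖((x - y, 0) : Phase N × ℝ)‖ = ‖x - y‖ := by simp [Prod.norm_def]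
  rw [hnorm] at hrem
  have hsplit : J (f x b - f y b) = J (D (x - y, 0)) + J R := by
    rw [← map_add, hR]; congr 1; abel
  have h1 : ⟪J (x - y), J (D (x - y, 0))⟫ ≤ -c * ‖x - y‖ ^ 2 := hdis (x - y)
  have h2 : ⟪J (x - y), J R⟫ ≤ ‖J‖ ^ 2 * κ * ‖x - y‖ ^ 2 := by
    refine (real_inner_le_norm _ _).trans ?_
    calc ‖J (x - y)‖ * ‖J R‖ ≤ (‖J‖ * ‖x - y‖) * (‖J‖ * (κ * ‖x - y‖)) := by
          gcongr
          · exact J.le_opNorm _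
          · exact (J.le_opNorm _).trans (by gcongr)
      _ = _ := by ring
  have h3 : ‖J (x - y)‖ ^ 2 ≤ ‖J‖ ^ 2 * ‖x - y‖ ^ 2 := by
    rw [← mul_pow]
    gcongr
    exact J.le_opNorm _
  have h4 : c = 2 * κ * (‖J‖ ^ 2 + 1) := by rw [hκ]; field_simp
  rw [hsplit, inner_add_right]
  nlinarith [mul_nonneg hκ0.le (sq_nonneg ‖x - y‖), mul_le_mul_of_nonneg_left h3 hκ0.le]

end DissipativeLinearization

/-! ### Cut-off, and uniqueness for the original field. -/

section Cutoff

/-- A `C¹` family of fields agrees on a given ball with a bounded, globally Lipschitz family. -/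
theorem ContDiff.exists_lipschitzWith_cutoff {N : ℕ} {f : Phase N → ℝ → Phase N}
    (hf : ContDiff ℝ 1 (fun z : Phase N × ℝ => f z.1 z.2)) (R : ℝ) :
    ∃ (G : Phase N → ℝ → Phase N) (L M : NNReal),
      LipschitzWith L (fun z : Phase N × ℝ => G z.1 z.2) ∧ (∀ x b, ‖G x b‖ ≤ M) ∧
      ∀ x b, ‖x‖ ≤ R → |b| ≤ R → G x b = f x b := by
  let χ : ContDiffBump (0 : Phase N × ℝ) :=
    ⟨max R 1, max R 1 + 1, lt_max_of_lt_right one_pos, lt_add_one _⟩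
  set g : Phase N × ℝ → Phase N := fun z => χ z • f z.1 z.2 with hg
  have hgc : ContDiff ℝ 1 g := χ.contDiff.smul hf
  have hgs : HasCompactSupport g := χ.hasCompactSupport.smul_right
  obtain ⟨M, hM⟩ := hgs.exists_bound_of_continuous hgc.continuous
  obtain ⟨L, hL⟩ := hgc.lipschitzWith_of_hasCompactSupport hgs one_ne_zero
  refine ⟨fun x b => g (x, b), L, M.toNNReal, hL,
    fun x b => (hM (x, b)).trans (Real.le_coe_toNNReal M), fun x b hx hb => ?_⟩
  have hmem : (x, b) ∈ Metric.closedBall (0 : Phase N × ℝ) χ.rIn := by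
    rw [mem_closedBall_zero_iff, Prod.norm_def]
    exact (max_le hx hb).trans (le_max_left R 1)
  simp [hg, χ.one_of_mem_closedBall hmem]

theorem LipschitzWith.prodMk_right_const {α β γ : Type*} [PseudoEMetricSpace α]
    [PseudoEMetricSpace β] [PseudoEMetricSpace γ] {g : α → β → γ} {L : NNReal}
    (hg : LipschitzWith L fun z : α × β => g z.1 z.2) (b : β) : LipschitzWith L fun x => g x b := by
  simpa using! hg.comp (LipschitzWith.prodMk_right b)

/-- Integral curves of a `C¹` family of fields along a continuous parameter are determined by their
initial value. -/
theorem ContDiff.eqOn_of_isIntegralCurveOn {N : ℕ} {f : Phase N → ℝ → Phase N}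
    (hf : ContDiff ℝ 1 (fun z : Phase N × ℝ => f z.1 z.2)) {μ : ℝ → ℝ} (hμ : Continuous μ)
    {a b : ℝ} {x y : ℝ → Phase N} (hx : IsIntegralCurveOn x (fun t q => f q (μ t)) (Icc a b))
    (hy : IsIntegralCurveOn y (fun t q => f q (μ t)) (Icc a b)) (h : x a = y a) :
    EqOn x y (Icc a b) := by
  obtain ⟨R₁, hR₁⟩ := isCompact_Icc.exists_bound_of_continuousOn hx.continuousOn
  obtain ⟨R₂, hR₂⟩ := isCompact_Icc.exists_bound_of_continuousOn hy.continuousOn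
  obtain ⟨R₃, hR₃⟩ := isCompact_Icc.exists_bound_of_continuousOn (hμ.continuousOn (s := Icc a b))
  obtain ⟨G, L, M, hL, -, hG⟩ := hf.exists_lipschitzWith_cutoff (max R₁ (max R₂ R₃))
  have hcurve : ∀ z : ℝ → Phase N, IsIntegralCurveOn z (fun t q => f q (μ t)) (Icc a b) →
      (∀ t ∈ Icc a b, ‖z t‖ ≤ max R₁ (max R₂ R₃)) →
      ∀ t ∈ Ico a b, HasDerivWithinAt z (G (z t) (μ t)) (Ici t) t := fun z hz hbd t ht => by
    have htI := Ico_subset_Icc_self ht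
    rw [hG _ _ (hbd t htI) ((hR₃ t htI).trans ((le_max_right _ _).trans (le_max_right _ _)))]
    exact (hz t htI).mono_of_mem_nhdsWithin (Icc_mem_nhdsGE_of_mem ht)
  exact ODE_solution_unique (v := fun t q => G q (μ t)) (K := L)
    (fun t => hL.prodMk_right_const (μ t)) hx.continuousOn
    (hcurve x hx fun t ht => (hR₁ t ht).trans (le_max_left _ _)) hy.continuousOn
    (hcurve y hy fun t ht => (hR₂ t ht).trans ((le_max_left _ _).trans (le_max_right _ _))) h

end Cutoff

/-! ### Subtangency from the inflow condition. -/

section Subtangent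

/-- The inflow condition of a forward inflowing stable path, whatever its rate `ρ`, makes the frozen
fields subtangent to the sets `K s`. -/
theorem eventually_infDist_le_of_inflowing {N : ℕ} {f : Phase N → ℝ → Phase N} {lam : ℝ → ℝ}
    {ρ s : ℝ} {K : Set (Phase N)} (hK : IsClosed K)
    (hin : ∀ x₀ ∈ frontier K, ∃ t₀ > 0, ∃ y : ℝ → Phase N,
      IsIntegralCurveOn y (fun t x => f x (lam (s + ρ * t))) (Ico 0 t₀) ∧ y 0 = x₀ ∧
      ∀ t ∈ Ioo 0 t₀, y t ∈ interior K)
    {p : Phase N} (hp : p ∈ K) {ε : ℝ} (hε : 0 < ε) :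
    ∀ᶠ h in 𝓝[>] (0 : ℝ), Metric.infDist (p + h • f p (lam s)) K ≤ ε * h := by
  by_cases hpi : p ∈ interior K
  · have hc : Tendsto (fun h : ℝ => p + h • f p (lam s)) (𝓝[>] 0) (𝓝 p) := by
      have : Continuous fun h : ℝ => p + h • f p (lam s) := by fun_prop
      simpa using (this.tendsto 0).mono_left (nhdsWithin_le_nhds (s := Ioi 0))
    filter_upwards [hc.eventually (mem_interior_iff_mem_nhds.1 hpi), self_mem_nhdsWithin]
      with h hh hpos
    rw [Metric.infDist_zero_of_mem hh]
    exact mul_nonneg hε.le (le_of_lt hpos)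
  · obtain ⟨t₀, ht₀, y, hy, hy0, hyK⟩ := hin p (hK.frontier_eq ▸ ⟨hp, hpi⟩)
    have h0 := hy 0 ⟨le_rfl, ht₀⟩
    simp only [hy0, mul_zero, add_zero] at h0
    exact eventually_infDist_le_of_hasDerivWithinAt ht₀ h0 hy0
      (fun t ht => interior_subset (hyK t ht)) hε

end Subtangent

/-! ### The main theorem. -/

theorem proposition1 {N : ℕ} (f : Phase N → ℝ → Phase N)
    (hf : ContDiff ℝ 1 (fun p : Phase N × ℝ => f p.1 p.2))
    (lam : ℝ → ℝ) (lamM lamP : ℝ) (X : ℝ → Phase N) (XM XP : Phase N)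
    (hpath : IsStablePath f lam lamM lamP X XM XP)
    (hXM : IsLinearlyStable (fun x => f x lamM) XM)
    (ρ : ℝ) (hρ : 0 ≤ ρ)
    (hFIS : ForwardInflowingStable f lam lamP X XM XP ρ) :
    ∀ r : ℝ, 0 < r →
      ∃ γ : ℝ → Phase N,
        IsPullbackAttractor (fun t x => f x (lam (r * t))) γ ∧
        Tendsto γ atBot (𝓝 XM) ∧
        (∀ γ' : ℝ → Phase N, IsIntegralCurve γ' (fun t x => f x (lam (r * t))) →
          Tendsto γ' atBot (𝓝 XM) → γ' = γ) ∧
        Tendsto γ atTop (𝓝 XP) ∧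
        IsForwardAttracting (fun t x => f x (lam (r * t))) γ := by
  intro r hr
  obtain ⟨K, hKc, -, hKmono, hKin, hXMK, hXPK, hKpc, hKpb⟩ := hFIS
  have hlam : Continuous lam := hpath.shift.differentiable.continuous
  have hlamr : Continuous fun t => lam (r * t) := by fun_prop
  have hmono : Monotone fun t => K (r * t) :=
    (monotone_iff_forall_lt.2 fun s t hst => hKmono s t hst).comp
      (monotone_id.const_mul hr.le)
  set Kp := closure (⋃ s, K s) with hKp
  have hKKp : ∀ s, K s ⊆ Kp := fun s => (subset_iUnion K s).trans subset_closure
  -- cut-off fields that agree with the given ones on the unit neighbourhood of `Kp`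
  obtain ⟨R₀, hR₀⟩ := hKpc.isBounded.exists_norm_le
  set R := max (R₀ + 1) (max |lamM| |lamP|) with hR
  obtain ⟨G, L, M, hL, hM, hGf⟩ := hf.exists_lipschitzWith_cutoff R
  have hRlam : ∀ s, |lam s| ≤ R := fun s =>
    (abs_le_max_abs_abs (hpath.shift.lower s).le (hpath.shift.upper s).le).trans (le_max_right _ _)
  have hRP : |lamP| ≤ R := (le_max_right _ _).trans (le_max_right _ _)
  have hRKp : ∀ x ∈ Kp, ‖x‖ ≤ R := fun x hx =>
    (hR₀ x hx).trans (by linarith [le_max_left (R₀ + 1) (max |lamM| |lamP|)])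
  set v : ℝ → Phase N → Phase N := fun t x => G x (lam (r * t)) with hv
  set w : Phase N → Phase N := fun x => G x lamP with hw
  have hGc : Continuous fun z : Phase N × ℝ => G z.1 z.2 := hL.continuous
  have hr_top : Tendsto (fun t : ℝ => r * t) atTop atTop := tendsto_id.const_mul_atTop hr
  have hr_bot : Tendsto (fun t : ℝ => r * t) atBot atBot := tendsto_id.const_mul_atBot hr
  have H : IsAsymptoticallyAutonomous v w L :=
    { lipschitz := fun t => hL.prodMk_right_const _
      lipschitz_limit := hL.prodMk_right_const _
      exists_curve := fun t₀ q => exists_isIntegralCurve (fun t => hL.prodMk_right_const _)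
        (fun q => hGc.comp (continuous_const.prodMk hlamr)) (fun t q => hM _ _) t₀ q
      exists_curve_limit := fun q => exists_isIntegralCurve (fun t => hL.prodMk_right_const _)
        (fun q => continuous_const) (fun t q => hM _ _) 0 q
      eventually_dist_le := fun ε hε => by
        have h1 : Tendsto (fun t => L * dist (lam (r * t)) lamP) atTop (𝓝 (L * 0)) :=
          (tendsto_iff_dist_tendsto_zero.1 (hpath.shift.tendsto_atTop.comp hr_top)).const_mul _
        rw [mul_zero] at h1
        filter_upwards [h1.eventually_le_const hε] with t ht q
        refine (hL.dist_le_mul (q, lam (r * t)) (q, lamP)).trans ?_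
        rwa [dist_prod_same_left] }
  have hvf : ∀ t x, ‖x‖ ≤ R → v t x = f x (lam (r * t)) := fun t x hx => hGf _ _ hx (hRlam _)
  have hcurve : ∀ (x : ℝ → Phase N) (S : Set ℝ), IsIntegralCurve x v → (∀ t ∈ S, ‖x t‖ ≤ R) →
      IsIntegralCurveOn x (fun t x => f x (lam (r * t))) S := fun x S hx hS t ht => by
    have := (hx t).hasDerivWithinAt (s := S)
    rwa [hvf t _ (hS t ht)] at this
  -- the sets `K (r * t)` trap the solutions
  have htrap : ∀ x : ℝ → Phase N, IsIntegralCurve x v → ∀ t₀ t, t₀ ≤ t → x t₀ ∈ K (r * t₀) →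
      x t ∈ K (r * t) := fun x hx t₀ t ht h0 =>
    hx.mem_of_subtangent H.lipschitz (fun t => hKc (r * t)) hmono
      (fun t p hp ε hε => by
        rw [hvf t p (hRKp p (hKKp _ hp))]
        exact eventually_infDist_le_of_inflowing (hKc _).isClosed (hKin (r * t)) hp hε) ht h0
  -- the limiting system on `Kp`
  have hKp_inv : ∀ y : ℝ → Phase N, IsIntegralCurve y (fun _ => w) → y 0 ∈ Kp → ∀ t ≥ 0,
      y t ∈ Kp := fun y hy hy0 t ht => by
    refine H.mem_of_mem_closure isClosed_closure (fun q hq => ?_) hy hy0 ht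
    obtain ⟨s, hs⟩ := mem_iUnion.1 hq
    filter_upwards [hr_top.eventually (eventually_gt_atTop s)] with t₀ ht₀ x hx hx0 t ht
    exact hKKp _ (htrap x hx t₀ t ht (hx0 ▸ hKmono _ _ ht₀ hs))
  -- The basin and stability hypotheses concern `f`; invariance of `Kp` carries them over to the
  -- cut-off field `w`.
  have hlimit : ∀ y z : ℝ → Phase N, IsIntegralCurve y (fun _ => w) → y 0 ∈ Kp →
      IsIntegralCurveOn z (fun _ x => f x lamP) (Ici 0) → z 0 = y 0 → ∀ t ≥ 0, y t = z t := by
    intro y z hy hy0 hz hz0 t ht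
    refine hf.eqOn_of_isIntegralCurveOn (μ := fun _ => lamP) continuous_const (a := 0) (b := t)
      (fun τ hτ => ?_) (hz.mono Icc_subset_Ici_self) hz0.symm ⟨ht, le_rfl⟩
    have : HasDerivWithinAt y (G (y τ) lamP) (Icc 0 t) τ := (hy τ).hasDerivWithinAt
    rwa [hGf _ _ (hRKp _ (hKp_inv y hy hy0 τ hτ.1)) hRP] at this
  have hatt : IsAttractedTo w Kp XP := fun y hy hy0 => by
    obtain ⟨z, hz, hz0, hzlim⟩ := hKpb hy0
    refine hzlim.congr' ?_
    filter_upwards [eventually_ge_atTop 0] with t ht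
    exact (hlimit y z hy hy0 hz hz0 t ht).symm
  obtain ⟨ρ', hρ', hρ'K⟩ := Metric.nhds_basis_closedBall.mem_iff.1
    (mem_interior_iff_mem_nhds.1 hXPK)
  have hstab : IsLyapunovStable w XP := fun ε hε => by
    obtain ⟨δ, hδ, h⟩ := hpath.attracting_atTop.stable ε hε
    refine ⟨min δ ρ', lt_min hδ hρ', fun y hy hy0 t ht => ?_⟩
    obtain ⟨z, hz, hz0, hzball⟩ := h (y 0) (Metric.ball_subset_ball (min_le_left _ _) hy0)
    rw [hlimit y z hy (hρ'K (Metric.ball_subset_closedBall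
      (Metric.ball_subset_ball (min_le_right _ _) hy0))) hz hz0 t ht]
    exact hzball t ht
  -- the solution that emanates from `XM`
  obtain ⟨m, J, c, r₀, hc, hr₀, hJ, hdis⟩ := hXM.exists_dissipative hf.contDiffAt
  obtain ⟨η₁, hη₁, hη₁K⟩ := Metric.nhds_basis_closedBall.mem_iff.1
    (mem_interior_iff_mem_nhds.1 hXMK)
  have hlamM := hpath.shift.tendsto_atBot.comp hr_bot
  obtain ⟨t₁, ht₁⟩ := eventually_atBot.1 (hlamM.eventually (Metric.ball_mem_nhds _ hr₀))
  set η₀ := min η₁ (r₀ / 2) with hη₀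
  have hη₀pos : 0 < η₀ := lt_min hη₁ (half_pos hr₀)
  have hηK : ∀ s, Metric.closedBall XM η₀ ⊆ K s := fun s =>
    (Metric.closedBall_subset_closedBall (min_le_left _ _)).trans (hη₁K.trans (iInter_subset K s))
  have hJball : ∀ x, ‖J (x - XM)‖ ≤ η₀ → x ∈ Metric.closedBall XM η₀ := fun x hx =>
    mem_closedBall_iff_norm.2 ((hJ _).trans hx)
  have hXMKp : XM ∈ Kp := hKKp 0 (hηK 0 (Metric.mem_closedBall_self hη₀pos.le))
  -- Needed for `f` as well as for `v`: uniqueness is claimed among all solutions of the original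
  -- system, including any that leave the cut-off region.
  have Df : IsDissipativeAtBot (fun t x => f x (lam (r * t))) J XM c η₀ t₁ :=
    { rate_pos := hc
      radius_pos := hη₀pos
      norm_le := hJ
      inner_le := fun t ht x y hx hy => by
        have hsub : Metric.closedBall XM η₀ ⊆ Metric.ball XM r₀ :=
          Metric.closedBall_subset_ball ((min_le_right _ _).trans_lt (half_lt_self hr₀))
        exact hdis _ (ht₁ t ht) x (hsub (hJball x hx)) y (hsub (hJball y hy))
      tendsto_zero := by
        have h1 : Tendsto (fun b => f XM b) (𝓝 lamM) (𝓝 (f XM lamM)) :=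
          (hf.continuous.comp (continuous_const.prodMk continuous_id)).tendsto lamM
        rw [show f XM lamM = 0 from hpath.attracting_atBot.equilibrium] at h1
        exact h1.comp hlamM }
  have Dv : IsDissipativeAtBot v J XM c η₀ t₁ :=
    { rate_pos := hc
      radius_pos := hη₀pos
      norm_le := hJ
      inner_le := fun t ht x y hx hy => by
        rw [hvf t x (hRKp x (hKKp 0 (hηK 0 (hJball x hx)))),
          hvf t y (hRKp y (hKKp 0 (hηK 0 (hJball y hy))))]
        exact Df.inner_le t ht x y hx hy
      tendsto_zero := Df.tendsto_zero.congr fun t => (hvf t XM (hRKp _ hXMKp)).symm }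
  obtain ⟨γ, hγ, hγM⟩ := Dv.exists_tendsto H.lipschitz H.exists_curve
  obtain ⟨δ₁, hδ₁, htube, hpull⟩ := Dv.exists_pullback H.lipschitz hγ hγM
  replace htube : ∀ᶠ s in atBot, Metric.ball (γ s) δ₁ ⊆ K (r * s) :=
    htube.mono fun s hs => hs.trans (hηK _)
  have hγK : ∀ t, γ t ∈ Kp := fun t => by
    obtain ⟨s, hs, hst⟩ := (htube.and (eventually_le_atBot t)).exists
    exact hKKp _ (htrap γ hγ s t hst (hs (Metric.mem_ball_self hδ₁)))
  have hγf : IsIntegralCurve γ (fun t x => f x (lam (r * t))) := isIntegralCurveOn_univ.1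
    (hcurve γ univ hγ fun t _ => hRKp _ (hγK t))
  have hγP : Tendsto γ atTop (𝓝 XP) :=
    H.tendsto hstab hKpc hatt hγ (Eventually.of_forall hγK)
  refine ⟨γ, ⟨hγf, δ₁, hδ₁, fun t ε hε => ?_⟩, hγM, fun γ' hγ' hγ'M => ?_, hγP, ?_⟩
  · filter_upwards [hpull t ε hε, htube, eventually_le_atBot t] with s hs hsK hst
    refine ⟨hst, fun x₀ hx₀ => ?_⟩
    obtain ⟨x, hx, rfl⟩ := H.exists_curve s x₀
    refine ⟨x, hcurve x _ hx fun τ hτ => hRKp _ (hKKp _ (htrap x hx s τ hτ.1 (hsK hx₀))), rfl, ?_⟩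
    rw [← dist_eq_norm]
    exact hs x hx hx₀
  · ext1 t
    obtain ⟨s, hs, hst⟩ :=
      ((Df.eventually_eq hγ' hγf hγ'M hγM).and (eventually_le_atBot t)).exists
    exact hf.eqOn_of_isIntegralCurveOn hlamr (hγ'.isIntegralCurveOn _) (hγf.isIntegralCurveOn _) hs
      ⟨hst, le_rfl⟩
  · obtain ⟨δ₂, hδ₂, t₂, ht₂⟩ := H.exists_forall_mem_ball hstab hρ'
      (fun y hy hy0 => hatt y hy (hρ'K hy0)) hρ'
    obtain ⟨t₃, ht₃⟩ := eventually_atTop.1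
      ((hγP.eventually (Metric.ball_mem_nhds XP (half_pos hδ₂))).and (eventually_ge_atTop t₂))
    obtain ⟨t₄, ht₄⟩ := eventually_atBot.1 htube
    -- `δ₂ / 2` brings `x` into the `δ₂`-ball around `XP` by time `max t₀ t₃`; `1` keeps it where
    -- the cut-off changes nothing. Starts before `t₄` are trapped at once, and for later ones the
    -- waiting time is at most `|t₃ - t₄|`, so one `δ` serves all `t₀`.
    set β := min (δ₂ / 2) 1 with hβ
    have hβpos : 0 < β := lt_min (half_pos hδ₂) one_pos
    set δ := min δ₁ (β * Real.exp (-(L * |t₃ - t₄|))) with hδ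
    have hδpos : 0 < δ := lt_min hδ₁ (by positivity)
    refine ⟨δ, hδpos, fun t₀ x₀ hx₀ => ?_⟩
    obtain ⟨x, hx, rfl⟩ := H.exists_curve t₀ x₀
    suffices hbd : (∀ t ≥ t₀, ‖x t‖ ≤ R) ∧ ∀ᶠ t in atTop, x t ∈ Kp by
      refine ⟨x, hcurve x _ hx hbd.1, rfl, ?_⟩
      have := ((H.tendsto hstab hKpc hatt hx hbd.2).sub hγP).norm
      rwa [sub_self, norm_zero] at this
    rcases le_total t₀ t₄ with h | h
    · have hmem : ∀ t ≥ t₀, x t ∈ Kp := fun t ht =>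
        hKKp _ (htrap x hx t₀ t ht (ht₄ t₀ h (Metric.ball_subset_ball (min_le_left _ _) hx₀)))
      exact ⟨fun t ht => hRKp _ (hmem t ht), (eventually_ge_atTop t₀).mono hmem⟩
    · have hnear : ∀ t ∈ Icc t₀ (max t₀ t₃), dist (x t) (γ t) < β := fun t ht => by
        have hlen : |t - t₀| ≤ |t₃ - t₄| := by
          rw [abs_of_nonneg (sub_nonneg.2 ht.1)]
          rcases le_max_iff.1 ht.2 with h' | h'
          · linarith [abs_nonneg (t₃ - t₄)]
          · linarith [le_abs_self (t₃ - t₄)]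
        calc dist (x t) (γ t) ≤ dist (x t₀) (γ t₀) * Real.exp (L * |t - t₀|) :=
              hx.dist_le_exp H.lipschitz hγ t₀ t
          _ ≤ dist (x t₀) (γ t₀) * Real.exp (L * |t₃ - t₄|) := by gcongr
          _ < β * Real.exp (-(L * |t₃ - t₄|)) * Real.exp (L * |t₃ - t₄|) := by
              gcongr
              exact (Metric.mem_ball.1 hx₀).trans_le (min_le_right _ _)
          _ = β := by rw [mul_assoc, ← Real.exp_add]; simp
      have hlate : ∀ t ≥ max t₀ t₃, x t ∈ Kp := by
        obtain ⟨h1, h2⟩ := ht₃ (max t₀ t₃) (le_max_right _ _)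
        have h3 := (hnear _ ⟨le_max_left _ _, le_rfl⟩).trans_le (min_le_left _ _)
        have h4 : x (max t₀ t₃) ∈ Metric.ball XP δ₂ := by
          rw [Metric.mem_ball]
          linarith [dist_triangle (x (max t₀ t₃)) (γ (max t₀ t₃)) XP]
        exact fun t ht => hρ'K (Metric.ball_subset_closedBall (ht₂ _ h2 x hx h4 t ht))
      refine ⟨fun t ht => ?_, (eventually_ge_atTop _).mono hlate⟩
      rcases le_total t (max t₀ t₃) with h' | h'
      · have h1 := (hnear t ⟨ht, h'⟩).trans_le (min_le_right _ _)
        rw [dist_eq_norm] at h1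
        have h2 := hR₀ _ (hγK t)
        have h3 : ‖x t‖ ≤ ‖γ t‖ + ‖x t - γ t‖ := norm_le_norm_add_norm_sub' _ _
        linarith [le_max_left (R₀ + 1) (max |lamM| |lamP|)]
      · exact hRKp _ (hlate t h')
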